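/- Let $M$ be a finite-dimensional smooth Hausdorff manifold without boundary with a smooth product $\cdot\colon M\times M\to M$ making it a symmetric space: $x\cdot x=x$, $x\cdot(x\cdot y)=y$, $x\cdot(y\cdot z)=(x\cdot y)\cdot(x\cdot z)$ for all $x,y,z\in M$, and every $x\in M$ has a neighbourhood $U$ such that $x\cdot y=y$ with $y\in U$ implies $y=x$. Fix a base point $o\in M$. Let $\sigma_x(y)=x\cdot y$ and $Q_x=\sigma_x\circ\sigma_o$. For $V\in T_oM$ let $\xi_V$ be the vector field $\xi_V(y)=\left.\frac{d}{dt}\right|_{t=0}Q_{\gamma(t)}(y)$, where $\gamma$ is any curve with $\gamma(0)=o$ and $\gamma'(0)=\frac12V$, and let $\operatorname{Exp}(V)$ be the value at $t=1$ of the solution of $y'(t)=\xi_V(y(t))$, $y(0)=o$. Equip $\mathbb R$ with the product $s\cdot t=2s-t$ and the base point $0$. Then for every $V\in T_oM$: 1. the initial value problem $y'(t)=\xi_V(y(t))$, $y(0)=o$ has exactly one solution on all of $\mathbb R$, namely $y(t)=\operatorname{Exp}(tV)$ (in particular $\operatorname{Exp}$ is well defined on all of $T_oM$); 2. the map $t\mapsto\operatorname{Exp}(tV)$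 is smooth, it is a homomorphism of pointed symmetric spaces $(\mathbb R,\cdot,0)\to(M,\cdot,o)$, that is, it sends $0$ to $o$ and $\operatorname{Exp}((s\cdot t)V)=\operatorname{Exp}(sV)\cdot\operatorname{Exp}(tV)$ for all $s,t\in\mathbb R$, and its derivative at $0$ is $V$; 3. it is the only such homomorphism: if $f\colon\mathbb R\to M$ satisfies $f(0)=o$ and $f(s\cdot t)=f(s)\cdot f(t)$ for all $s,t\in\mathbb R$, and $f$ is differentiable at $0$ with $f'(0)=V$, then $f(t)=\operatorname{Exp}(tV)$ for all $t\in\mathbb R$; 4. $\operatorname{Exp}(V)=Q_{\operatorname{Exp}(\frac12V)}\,o$. -/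

import Mathlib

open scoped Manifold ContDiff Topology

/-- A symmetric space: a smooth product `x · y = op x y` on the manifold `M` such that every symmetry
`y ↦ x · y` is an involutive automorphism having `x` as an isolated fixed point. -/
structure SymmetricSpace {E : Type*} [NormedAddCommGroup E] [NormedSpace ℝ E]
    {H : Type*} [TopologicalSpace H] (I : ModelWithCorners ℝ E H)
    (M : Type*) [TopologicalSpace M] [ChartedSpace H M] where
  op : M → M → M
  contMDiff_op : ContMDiff (I.prod I) I ∞ (fun p : M × M => op p.1 p.2)
  op_self : ∀ x, op x x = x
  op_op_left : ∀ x y, op x (op x y) = y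
  op_distrib : ∀ x y z, op x (op y z) = op (op x y) (op x z)
  isolated : ∀ x, ∃ U ∈ 𝓝 x, ∀ y ∈ U, op x y = y → y = x

namespace SymmetricSpace

/-- The real line with the symmetric product `s · t = 2 s - t`. -/
def realLine : SymmetricSpace 𝓘(ℝ, ℝ) ℝ where
  op s t := 2 * s - t
  contMDiff_op :=
    (contDiff_const.mul contDiff_id : ContDiff ℝ ∞ fun s : ℝ => 2 * s).contMDiff.comp
      contMDiff_fst |>.sub contMDiff_snd
  op_self x := by ring
  op_op_left x y := by ring
  op_distrib x y z := by ring
  isolated x := ⟨Set.univ, Filter.univ_mem, fun y _ h => by linarith⟩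

section

variable {E : Type*} [NormedAddCommGroup E] [NormedSpace ℝ E]
  {H : Type*} [TopologicalSpace H] {I : ModelWithCorners ℝ E H}
  {M : Type*} [TopologicalSpace M] [ChartedSpace H M]
  {E' : Type*} [NormedAddCommGroup E'] [NormedSpace ℝ E']
  {H' : Type*} [TopologicalSpace H'] {I' : ModelWithCorners ℝ E' H'}
  {N : Type*} [TopologicalSpace N] [ChartedSpace H' N]

/-- `f` is a homomorphism of pointed symmetric spaces `(N, ·, p) → (M, ·, o)`: it preserves the base
point and the product. (Smoothness is stated separately where it is claimed.) -/
structure IsPointedHom (R : SymmetricSpace I' N) (p : N) (S : SymmetricSpace I M) (o : M)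
    (f : N → M) : Prop where
  map_base : f p = o
  map_op : ∀ x y, f (R.op x y) = S.op (f x) (f y)

/-- The symmetry `σ_x y = x · y`. -/
def sym (S : SymmetricSpace I M) (x y : M) : M := S.op x y

/-- The quadratic representation with base point `o`: `Q_x = σ_x ∘ σ_o`. -/
def quadRep (S : SymmetricSpace I M) (o x y : M) : M := S.sym x (S.sym o y)

/-- The vector field `ξ_V(y) = d/dt|₀ Q_{γ(t)}(y)` where `γ(0) = o`, `γ'(0) = V / 2`, that is, the
derivative at `o` of `x ↦ Q_x y`, applied to `V / 2`. It is a tangent vector at `Q_o y`, and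
`Q_o y = y`. -/
noncomputable def xi (S : SymmetricSpace I M) (o : M) (V : TangentSpace I o) (y : M) :
    TangentSpace I y :=
  mfderiv I I (fun x : M => S.quadRep o x y) o ((1 / 2 : ℝ) • V)

open Classical in
/-- The geodesic exponential at `o`: the value at time `1` of the global solution of
`y' = ξ_V(y)`, `y(0) = o` (and `o` if there were no such solution). -/
noncomputable def geodesicExp (S : SymmetricSpace I M) (o : M) (V : TangentSpace I o) : M :=
  if h : ∃ γ : ℝ → M, γ 0 = o ∧ IsMIntegralCurve (I := I) γ (S.xi o V) then h.choose 1 else o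

/-- The curve `f` starts at `o` and has derivative `V ∈ T_o M` at time `0`. -/
def HasInitialVelocity (f : ℝ → M) (o : M) (V : TangentSpace I o) : Prop :=
  f 0 = o ∧ HasMFDerivAt 𝓘(ℝ, ℝ) I f 0 ((1 : ℝ →L[ℝ] ℝ).smulRight V)

end

end SymmetricSpace

/-- The derivative of a local involution at an isolated fixed point is `-id`. -/
theorem HasStrictFDerivAt.eq_neg_id_of_involution {E : Type*} [NormedAddCommGroup E]
    [NormedSpace ℝ E] [CompleteSpace E] {s : E → E} {A : E →L[ℝ] E} {a : E}
    (hs : HasStrictFDerivAt s A a) (hsa : s a = a) (hinv : ∀ᶠ x in 𝓝 a, s (s x) = x)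
    (hiso : ∀ᶠ x in 𝓝 a, s x = x → x = a) (v : E) : A v = -v := by
  have hAA (w : E) : A (A w) = w := by
    have h₁ : HasFDerivAt (s ∘ s) (A ∘L A) a :=
      HasFDerivAt.comp a (by rw [hsa]; exact hs.hasFDerivAt) hs.hasFDerivAt
    have h₂ : HasFDerivAt (s ∘ s) (ContinuousLinearMap.id ℝ E) a :=
      (hasFDerivAt_id a).congr_of_eventuallyEq (by filter_upwards [hinv] with x hx using hx)
    simpa using congrArg (fun B : E →L[ℝ] E => B w) (h₁.unique h₂)
  -- `h` conjugates `s` to its linear part `A`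
  obtain ⟨h, hderiv, hconj⟩ : ∃ h : E → E,
      HasStrictFDerivAt h ((ContinuousLinearEquiv.refl ℝ E : E ≃L[ℝ] E) : E →L[ℝ] E) a ∧
      ∀ᶠ x in 𝓝 a, h (s x) = A (h x) := by
    refine ⟨fun x => (2 : ℝ)⁻¹ • (x + A (s x)), ?_, ?_⟩
    · have h₁ := ((hasStrictFDerivAt_id a).add (A.hasStrictFDerivAt.comp a hs)).const_smul
        (2 : ℝ)⁻¹
      convert! h₁ using 1
      ext w
      simp [hAA, ← add_smul, ← two_mul]
    · filter_upwards [hinv] with x hx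
      simp [hx, hAA, add_comm]
  have hAfix (w : E) (hw : A w = w) : w = 0 := by
    obtain ⟨g, hgdef⟩ : ∃ g, hderiv.localInverse h _ a = g := ⟨_, rfl⟩
    have hAa : A (h a) = h a := by
      rw [← hconj.self_of_nhds, hsa]
    have hline : Filter.Tendsto (fun ε : ℝ => h a + ε • w) (𝓝 0) (𝓝 (h a)) := by
      have : Continuous fun ε : ℝ => h a + ε • w := by fun_prop
      simpa using this.tendsto 0
    have hscont : Filter.Tendsto s (𝓝 a) (𝓝 a) := by
      simpa [hsa] using hs.continuousAt.tendsto
    have hg : Filter.Tendsto (fun ε : ℝ => g (h a + ε • w)) (𝓝 0) (𝓝 a) :=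
      hgdef ▸ hderiv.localInverse_tendsto.comp hline
    have hev : ∀ᶠ ε : ℝ in 𝓝 0, ε • w = 0 := by
      filter_upwards [hline.eventually hderiv.eventually_right_inverse,
        hg.eventually (hscont.eventually hderiv.eventually_left_inverse),
        hg.eventually hconj, hg.eventually hiso] with ε h₁ h₃ h₄ h₅
      rw [hgdef] at h₁ h₃
      have hfix : s (g (h a + ε • w)) = g (h a + ε • w) := by
        rw [← h₃, h₄, h₁, map_add, map_smul, hAa, hw]
      rw [h₅ hfix] at h₁
      simpa using h₁.symm
    obtain ⟨ε, hε, hε'⟩ := ((hev.filter_mono nhdsWithin_le_nhds).and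
      (self_mem_nhdsWithin : {0}ᶜ ∈ 𝓝[≠] (0 : ℝ))).exists
    exact (smul_eq_zero.1 hε).resolve_left hε'
  have := hAfix (v + A v) (by rw [map_add, hAA, add_comm])
  exact eq_neg_of_add_eq_zero_right this

section IntegralCurve

variable {E : Type*} [NormedAddCommGroup E] [NormedSpace ℝ E]
  {H : Type*} [TopologicalSpace H] {I : ModelWithCorners ℝ E H}
  {M : Type*} [TopologicalSpace M] [ChartedSpace H M]

/-- Integral curves of smooth vector fields are smooth. -/
theorem IsMIntegralCurve.contMDiff [IsManifold I ∞ M] {v : (x : M) → TangentSpace I x}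
    {γ : ℝ → M} (hγ : IsMIntegralCurve (I := I) γ v)
    (hv : ContMDiff I I.tangent ∞ (fun x => (⟨x, v x⟩ : TangentBundle I M))) :
    ContMDiff 𝓘(ℝ, ℝ) I ∞ γ := by
  have : IsManifold I 1 M := .of_le (n := ∞) (by exact_mod_cast le_top)
  rw [contMDiff_infty]
  intro n
  induction n with
  | zero => exact contMDiff_zero_iff.2 hγ.continuous
  | succ n ih =>
    intro t₀
    rw [contMDiffAt_iff]
    refine ⟨hγ.continuous.continuousAt, ?_⟩
    have hcomp : ContMDiffAt 𝓘(ℝ, ℝ) I.tangent n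
        (fun t => (⟨γ t, v (γ t)⟩ : TangentBundle I M)) t₀ :=
      ((hv.of_le (by exact_mod_cast le_top)).comp ih) t₀
    have hcoord := (Bundle.contMDiffAt_totalSpace.1 hcomp).2.contDiffAt
    simp only [TangentBundle.trivializationAt_apply] at hcoord
    have hd := (hγ.isMIntegralCurveAt t₀).eventually_hasDerivAt
    obtain ⟨u, hu, hu'⟩ := Filter.eventually_iff_exists_mem.1 hd
    simp only [extChartAt_model_space_eq_id, modelWithCornersSelf_coe, Set.range_id,
      contDiffWithinAt_univ, PartialEquiv.refl_symm, PartialEquiv.refl_coe, id_eq, Function.comp_id]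
    push_cast
    rw [contDiffAt_succ_iff_hasFDerivAt]
    refine ⟨_, ⟨u, hu, fun t ht => (hu' t ht).hasFDerivAt⟩, ?_⟩
    exact (ContinuousLinearMap.toSpanSingletonCLE (𝕜 := ℝ) (E := E)).contDiff.contDiffAt.comp t₀ hcoord

end IntegralCurve

section

variable {E : Type*} [NormedAddCommGroup E] [NormedSpace ℝ E]
  {H : Type*} [TopologicalSpace H] {I : ModelWithCorners ℝ E H}
  {M : Type*} [TopologicalSpace M] [ChartedSpace H M]
  {E' : Type*} [NormedAddCommGroup E'] [NormedSpace ℝ E']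
  {H' : Type*} [TopologicalSpace H'] {I' : ModelWithCorners ℝ E' H'}
  {N : Type*} [TopologicalSpace N] [ChartedSpace H' N]

/-- The velocity of the image of a curve under a differentiable map. -/
theorem HasMFDerivWithinAt.comp_smulRight {γ : ℝ → M} {s : Set ℝ} {t : ℝ}
    {v : TangentSpace I (γ t)} {f : M → N}
    (hγ : HasMFDerivWithinAt 𝓘(ℝ, ℝ) I γ s t ((1 : ℝ →L[ℝ] ℝ).smulRight v))
    (hf : MDifferentiableAt I I' f (γ t)) :
    HasMFDerivWithinAt 𝓘(ℝ, ℝ) I' (f ∘ γ) s t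
      ((1 : ℝ →L[ℝ] ℝ).smulRight (mfderiv I I' f (γ t) v)) :=
  (hf.hasMFDerivAt.comp_hasMFDerivWithinAt t hγ).congr_mfderiv 
    (ContinuousLinearMap.ext fun a : ℝ => map_smul (mfderiv I I' f (γ t)) a v)

end

namespace SymmetricSpace

variable {E : Type*} [NormedAddCommGroup E] [NormedSpace ℝ E]
  {H : Type*} [TopologicalSpace H] {I : ModelWithCorners ℝ E H}
  {M : Type*} [TopologicalSpace M] [ChartedSpace H M]

theorem contMDiff_sym (S : SymmetricSpace I M) (x : M) : ContMDiff I I ∞ (S.op x) :=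
  S.contMDiff_op.comp (contMDiff_const.prodMk contMDiff_id)

theorem contMDiff_quadRep_uncurry (S : SymmetricSpace I M) (o : M) :
    ContMDiff (I.prod I) I ∞ (fun p : M × M => S.quadRep o p.1 p.2) :=
  S.contMDiff_op.comp (contMDiff_fst.prodMk ((S.contMDiff_sym o).comp contMDiff_snd))

theorem mdifferentiableAt_op (S : SymmetricSpace I M) (p : M × M) :
    MDifferentiableAt (I.prod I) I (fun p : M × M => S.op p.1 p.2) p :=
  S.contMDiff_op.mdifferentiable (by simp) p

theorem mdifferentiableAt_quadRep (S : SymmetricSpace I M) (o x y : M) :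
    MDifferentiableAt I I (fun x => S.quadRep o x y) x :=
  ((S.contMDiff_quadRep_uncurry o).comp (contMDiff_id.prodMk contMDiff_const)).mdifferentiable
    (by simp) x

theorem quadRep_base (S : SymmetricSpace I M) (o y : M) : S.quadRep o o y = y :=
  S.op_op_left o y

theorem quadRep_apply_base (S : SymmetricSpace I M) (o x : M) : S.quadRep o x o = S.op x o := by
  simp only [quadRep, sym, S.op_self]

theorem quadRep_op (S : SymmetricSpace I M) (o x y z : M) :
    S.quadRep o x (S.op y z) = S.op (S.quadRep o x y) (S.quadRep o x z) := by
  simp only [quadRep, sym]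
  rw [S.op_distrib o, S.op_distrib x]

/-- The symmetry at a point acts as `-1` on the tangent space at this point. -/
theorem mfderiv_sym_self [CompleteSpace E] [I.Boundaryless] [IsManifold I ∞ M]
    (S : SymmetricSpace I M) (o : M) (v : TangentSpace I o) :
    (mfderiv I I (S.op o) o v : E) = -v := by
  have hmd : MDifferentiableAt I I (S.op o) o := (S.contMDiff_sym o).mdifferentiable (by simp) o
  let e := extChartAt I o
  let s : E → E := e ∘ S.op o ∘ e.symm
  have hcd : ContDiffAt ℝ ∞ s (e o) := by
    have h := (contMDiffAt_iff.1 ((S.contMDiff_sym o).contMDiffAt (x := o))).2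
    rw [I.range_eq_univ, contDiffWithinAt_univ, S.op_self] at h
    exact h
  have hA : mfderiv I I (S.op o) o = fderiv ℝ s (e o) := by
    rw [hmd.mfderiv, I.range_eq_univ, fderivWithin_univ]
    simp only [writtenInExtChartAt, S.op_self]
    rfl
  have hsymm : Filter.Tendsto e.symm (𝓝 (e o)) (𝓝 o) := by
    simpa [e] using (continuousAt_extChartAt_symm (I := I) o).tendsto
  have hop : Filter.Tendsto (S.op o) (𝓝 o) (𝓝 o) := by
    simpa [S.op_self] using (S.contMDiff_sym o).continuous.tendsto o
  have hsrc : ∀ᶠ y in 𝓝 o, y ∈ e.source := extChartAt_source_mem_nhds (I := I) o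
  have htgt : ∀ᶠ u in 𝓝 (e o), u ∈ e.target := extChartAt_target_mem_nhds (I := I) o
  have hstrict : HasStrictFDerivAt s (fderiv ℝ s (e o)) (e o) :=
    hcd.hasStrictFDerivAt (by simp)
  have hbase : e.symm (e o) = o := extChartAt_to_inv (I := I) o
  rw [hA]
  refine hstrict.eq_neg_id_of_involution ?_ ?_ ?_ v
  · simp only [s, Function.comp_apply, hbase, S.op_self]
  · filter_upwards [htgt, hsymm.eventually (hop.eventually hsrc)] with u hu hu'
    simp only [s, Function.comp_apply, e.left_inv hu', S.op_op_left, e.right_inv hu]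
  · obtain ⟨U, hU, hfix⟩ := S.isolated o
    filter_upwards [htgt, hsymm.eventually (hop.eventually hsrc), hsymm.eventually hU]
      with u hu hu' hu'' hsu
    have h := congrArg e.symm hsu
    simp only [s, Function.comp_apply, e.left_inv hu'] at h
    rw [← e.right_inv hu, hfix _ hu'' h]

/-- The orbit map `x ↦ x · o` has derivative `2` at `o`. -/
theorem mfderiv_op_base_right [CompleteSpace E] [I.Boundaryless] [IsManifold I ∞ M]
    (S : SymmetricSpace I M) (o : M) (v : TangentSpace I o) :
    (mfderiv I I (fun x => S.op x o) o v : E) = (2 : ℝ) • v := by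
  have hdiag : MDifferentiableAt I (I.prod I) (fun x : M => (x, x)) o :=
    mdifferentiableAt_id.prodMk mdifferentiableAt_id
  have h₁ : (mfderiv I I (fun x : M => S.op x x) o v : E) = v := by
    have : (fun x : M => S.op x x) = id := funext S.op_self
    rw [this, mfderiv_id]
    rfl
  have h₂ : (mfderiv I I (fun x : M => S.op x x) o v : E)
      = (mfderiv (I.prod I) I (fun p : M × M => S.op p.1 p.2) (o, o) ((v, v) : E × E) : E) := by
    have h := mfderiv_comp_apply_of_eq (x := o) (f := fun x : M => (x, x)) (S.mdifferentiableAt_op (o, o))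
      hdiag rfl v
    have hd : mfderiv I (I.prod I) (fun x : M => (x, x)) o
        = (ContinuousLinearMap.id ℝ E).prod (ContinuousLinearMap.id ℝ E) := by
      have h := mfderiv_prodMk (I := I) (I' := I) (I'' := I) (f := id) (g := id)
        (mdifferentiableAt_id (x := o)) mdifferentiableAt_id
      rw [mfderiv_id] at h
      exact h
    rw [hd] at h
    exact h
  have h₃ := mfderiv_prod_eq_add_apply (v := ((v, v) : E × E)) (S.mdifferentiableAt_op (o, o))
  have h₄ : v = (mfderiv I I (fun x => S.op x o) o v : E) + (mfderiv I I (S.op o) o v : E) :=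
    h₁.symm.trans (h₂.trans h₃)
  rw [S.mfderiv_sym_self] at h₄
  rw [two_smul]
  exact (eq_add_neg_iff_add_eq.1 h₄).symm

theorem xi_base [CompleteSpace E] [I.Boundaryless] [IsManifold I ∞ M]
    (S : SymmetricSpace I M) (o : M) (V : TangentSpace I o) : S.xi o V o = V := by
  have h : (fun x => S.quadRep o x o) = fun x => S.op x o := funext (S.quadRep_apply_base o)
  have h' : (mfderiv I I (fun x => S.quadRep o x o) o ((1 / 2 : ℝ) • V) : E) = V := by
    rw [h]
    refine (S.mfderiv_op_base_right o _).trans ?_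
    exact (smul_smul (2 : ℝ) (1 / 2 : ℝ) (V : E)).trans (by norm_num)
  exact h'

theorem xi_smul (S : SymmetricSpace I M) (o : M) (c : ℝ) (V : TangentSpace I o) :
    S.xi o (c • V) = c • S.xi o V := by
  funext y
  simp only [xi, Pi.smul_apply]
  rw [smul_comm, map_smul]
  rfl

/-- `ξ_V` is a derivation of the product. -/
theorem mfderiv_op_xi (S : SymmetricSpace I M) (o : M) (V : TangentSpace I o) (y z : M) :
    mfderiv (I.prod I) I (fun p : M × M => S.op p.1 p.2) (y, z) (S.xi o V y, S.xi o V z)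
      = S.xi o V (S.op y z) := by
  have hy := S.mdifferentiableAt_quadRep o o y
  have hz := S.mdifferentiableAt_quadRep o o z
  have hcomp := mfderiv_comp_apply_of_eq (x := o) (S.mdifferentiableAt_op (y, z)) (hy.prodMk hz)
    (by simp only [quadRep_base]) ((1 / 2 : ℝ) • V)
  rw [mfderiv_prodMk hy hz] at hcomp
  have hfun : (fun x => S.quadRep o x (S.op y z)) = (fun p : M × M => S.op p.1 p.2) ∘
      fun x => (S.quadRep o x y, S.quadRep o x z) := funext fun x => S.quadRep_op o x y z
  have hfun' : mfderiv I I (fun x => S.quadRep o x (S.op y z)) o ((1 / 2 : ℝ) • V) =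
      (mfderiv I I ((fun p : M × M => S.op p.1 p.2) ∘
        fun x => (S.quadRep o x y, S.quadRep o x z)) o ((1 / 2 : ℝ) • V) : E) := by
    rw [hfun]
    rfl
  exact (hfun'.trans hcomp).symm

theorem contMDiff_xi [IsManifold I ∞ M] (S : SymmetricSpace I M) (o : M)
    (V : TangentSpace I o) :
    ContMDiff I I.tangent ∞ (fun y => (⟨y, S.xi o V y⟩ : TangentBundle I M)) := by
  let W : TangentSpace I o := (1 / 2 : ℝ) • V
  have hF : ContMDiff I ((I.tangent).prod I.tangent) ∞ (fun y : M =>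
      ((⟨o, W⟩, Bundle.zeroSection E (TangentSpace I) y) :
        TangentBundle I M × TangentBundle I M)) :=
    contMDiff_const.prodMk (Bundle.contMDiff_zeroSection ℝ (TangentSpace I : M → Type _))
  have hG := ((S.contMDiff_quadRep_uncurry o).contMDiff_tangentMap (m := ∞) le_rfl).comp
    ((contMDiff_equivTangentBundleProd_symm (n := ∞) (I := I) (M := M) (I' := I) (M' := M)).comp hF)
  convert! hG using 1
  funext y
  have hmd : MDifferentiableAt (I.prod I) I (fun p : M × M => S.quadRep o p.1 p.2) (o, y) :=
    (S.contMDiff_quadRep_uncurry o).mdifferentiable (by simp) _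
  have h := mfderiv_prod_eq_add_apply (v := ((W, 0) : E × E)) hmd
  refine Bundle.TotalSpace.ext (S.quadRep_base o y).symm (heq_of_eq ?_)
  refine Eq.trans ?_ h.symm
  have h0 : mfderiv I I (fun z => S.quadRep o o z) y (0 : E) = (0 : E) := map_zero _
  exact ((congrArg (HAdd.hAdd (α := E) (β := E) (γ := E)
    (mfderiv I I (fun z => S.quadRep o z y) o W)) h0).trans (add_zero _)).symm

/-- The product of two integral curves of `ξ_V` is an integral curve. -/
theorem isMIntegralCurveOn_op {S : SymmetricSpace I M} {o : M} {V : TangentSpace I o}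
    {α β : ℝ → M} {s : Set ℝ} (hα : IsMIntegralCurveOn (I := I) α (S.xi o V) s)
    (hβ : IsMIntegralCurveOn (I := I) β (S.xi o V) s) :
    IsMIntegralCurveOn (I := I) (fun t => S.op (α t) (β t)) (S.xi o V) s := by
  intro t ht
  have h := HasMFDerivWithinAt.comp_smulRight
    (v := ((S.xi o V (α t), S.xi o V (β t)) : E × E))
    (f := fun p : M × M => S.op p.1 p.2) (γ := fun t => (α t, β t))
    (((hα t ht).prodMk (hβ t ht)).congr_mfderiv (by ext <;> rfl)) (S.mdifferentiableAt_op _)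
  rw [← mfderiv_op_xi]
  exact h

theorem mfderiv_sym_xi [CompleteSpace E] [I.Boundaryless] [IsManifold I ∞ M]
    (S : SymmetricSpace I M) (o : M) (V : TangentSpace I o) (y : M) :
    mfderiv I I (S.op o) y (S.xi o V y) = -S.xi o V (S.op o y) := by
  have h₁ := mfderiv_comp_apply_of_eq (x := o)
    ((S.contMDiff_sym o).mdifferentiable (by simp) y) (S.mdifferentiableAt_quadRep o o y)
    (S.quadRep_base o y) ((1 / 2 : ℝ) • V)
  have h₂ := mfderiv_comp_apply_of_eq (x := o) (S.mdifferentiableAt_quadRep o o (S.op o y))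
    ((S.contMDiff_sym o).mdifferentiable (by simp) o) (S.op_self o) ((1 / 2 : ℝ) • V)
  have hfun : S.op o ∘ (fun x => S.quadRep o x y)
      = (fun x => S.quadRep o x (S.op o y)) ∘ S.op o := by
    funext x
    simp only [Function.comp_apply, quadRep, sym, S.op_op_left]
    rw [S.op_distrib o, S.op_op_left]
  have h₃ : (mfderiv I I (S.op o) o ((1 / 2 : ℝ) • V) : E) = -((1 / 2 : ℝ) • V : E) :=
    S.mfderiv_sym_self o _
  rw [hfun] at h₁
  have h₄ := h₁.symm.trans h₂
  exact h₄.trans ((congrArg _ h₃).trans (map_neg _ _))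

/-- The symmetry at the base point reverses integral curves of `ξ_V`. -/
theorem isMIntegralCurveOn_sym_neg [CompleteSpace E] [I.Boundaryless] [IsManifold I ∞ M]
    {S : SymmetricSpace I M} {o : M} {V : TangentSpace I o} {α : ℝ → M} {s : Set ℝ}
    (hα : IsMIntegralCurveOn (I := I) α (S.xi o V) s) :
    IsMIntegralCurveOn (I := I) (fun t => S.op o (α (-t))) (S.xi o V) {t | -t ∈ s} := by
  intro t ht
  have hneg := hα.comp_mul (-1)
  simp only [mul_neg, mul_one, neg_smul, one_smul] at hneg
  have h := (hneg t ht).comp_smulRight ((S.contMDiff_sym o).mdifferentiable (by simp) _)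
  have hv : mfderiv I I (S.op o) (α (-t)) ((-S.xi o V) (α (-t)))
      = S.xi o V (S.op o (α (-t))) := by
    rw [Pi.neg_apply, map_neg, mfderiv_sym_xi, neg_neg]
  rw [← hv]
  exact h

end SymmetricSpace

namespace SymmetricSpace

variable {E : Type*} [NormedAddCommGroup E] [NormedSpace ℝ E]
  {H : Type*} [TopologicalSpace H] {I : ModelWithCorners ℝ E H}
  {M : Type*} [TopologicalSpace M] [ChartedSpace H M]

/-- Homomorphisms `(ℝ, ·, 0) → (M, ·, o)` with velocity `V` at `0` are integral curves of `ξ_V`. -/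
theorem IsPointedHom.isMIntegralCurve {S : SymmetricSpace I M} {o : M} {V : TangentSpace I o}
    {f : ℝ → M} (hf : IsPointedHom realLine 0 S o f) (hV : HasInitialVelocity f o V) :
    IsMIntegralCurve (I := I) f (S.xi o V) := by
  intro t
  let g : ℝ → ℝ := fun u => (1 / 2 : ℝ) * (u - t)
  have hgt : g t = 0 := by simp [g]
  have hfun : f = (fun x => S.quadRep o x (f t)) ∘ (f ∘ g) := by
    funext u
    have hop (s r : ℝ) : f (2 * s - r) = S.op (f s) (f r) := hf.map_op s r
    simp only [Function.comp_apply, quadRep, sym]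
    rw [← hf.map_base, ← hop, ← hop]
    congr 1
    simp only [g]
    ring
  have hg : HasMFDerivAt 𝓘(ℝ, ℝ) 𝓘(ℝ, ℝ) g t ((1 / 2 : ℝ) • (1 : ℝ →L[ℝ] ℝ)) :=
    (((hasFDerivAt_id t).sub_const t).const_mul (1 / 2 : ℝ)).hasMFDerivAt
  have hf0 : HasMFDerivAt 𝓘(ℝ, ℝ) I f (g t) ((1 : ℝ →L[ℝ] ℝ).smulRight (V : E)) := by
    rw [hgt]
    exact hV.2
  have hfg : HasMFDerivAt 𝓘(ℝ, ℝ) I (f ∘ g) t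
      ((1 : ℝ →L[ℝ] ℝ).smulRight ((1 / 2 : ℝ) • (V : E))) :=
    (hf0.comp t hg).congr_mfderiv (ContinuousLinearMap.ext fun a : ℝ => by
      change ((1 / 2 : ℝ) • a) • (V : E) = a • ((1 / 2 : ℝ) • V : E)
      rw [smul_assoc, smul_comm])
  have h := HasMFDerivWithinAt.comp_smulRight hfg.hasMFDerivWithinAt
    (s := Set.univ) (S.mdifferentiableAt_quadRep o _ (f t))
  have hxi (y : M) (hy : y = o) :
      (mfderiv I I (fun x => S.quadRep o x (f t)) y ((1 / 2 : ℝ) • (V : E)) : E)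
        = S.xi o V (f t) := by
    subst hy
    rfl
  have hcongr (φ : ℝ → M) (hφ : φ = f) (W : E)
      (hW : HasMFDerivAt 𝓘(ℝ, ℝ) I φ t ((1 : ℝ →L[ℝ] ℝ).smulRight W)) :
      HasMFDerivAt 𝓘(ℝ, ℝ) I f t ((1 : ℝ →L[ℝ] ℝ).smulRight W) := by
    subst hφ
    exact hW
  refine hcongr _ hfun.symm _ ((hasMFDerivWithinAt_univ.1 h).congr_mfderiv ?_)
  have hfg0 : (f ∘ g) t = o := by rw [Function.comp_apply, hgt, hf.map_base]
  exact congrArg (fun W : E => (1 : ℝ →L[ℝ] ℝ).smulRight W) (hxi _ hfg0)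

variable [IsManifold I ∞ M]

theorem contMDiff_one_xi (S : SymmetricSpace I M) (o : M) (V : TangentSpace I o) :
    ContMDiff I I.tangent 1 (fun y => (⟨y, S.xi o V y⟩ : TangentBundle I M)) :=
  (S.contMDiff_xi o V).of_le (by exact_mod_cast le_top)

variable [I.Boundaryless]

theorem eq_of_isMIntegralCurve_xi [T2Space M] {S : SymmetricSpace I M} {o : M} {V : TangentSpace I o}
    {α β : ℝ → M} (hα : IsMIntegralCurve (I := I) α (S.xi o V))
    (hβ : IsMIntegralCurve (I := I) β (S.xi o V)) (h : α 0 = β 0) : α = β := by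
  have : IsManifold I 1 M := .of_le (n := ∞) (by exact_mod_cast le_top)
  exact isMIntegralCurve_Ioo_eq_of_contMDiff_boundaryless (S.contMDiff_one_xi o V) hα hβ h

/-- The maximal integral curve of `ξ_V` through `o` is `t ↦ Exp(tV)`. -/
theorem eq_geodesicExp_of_isMIntegralCurve [T2Space M] {S : SymmetricSpace I M} {o : M}
    {V : TangentSpace I o} {γ : ℝ → M} (h0 : γ 0 = o)
    (hγ : IsMIntegralCurve (I := I) γ (S.xi o V)) :
    γ = fun t : ℝ => S.geodesicExp o (t • V) := by
  funext t
  have ht : IsMIntegralCurve (I := I) (γ ∘ (· * t)) (S.xi o (t • V)) := by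
    rw [xi_smul]
    exact hγ.comp_mul t
  have h : ∃ c : ℝ → M, c 0 = o ∧ IsMIntegralCurve (I := I) c (S.xi o (t • V)) :=
    ⟨_, by simp [h0], ht⟩
  have hc := eq_of_isMIntegralCurve_xi h.choose_spec.2 ht (by rw [h.choose_spec.1]; simp [h0])
  rw [geodesicExp, dif_pos h, hc]
  simp

variable [CompleteSpace E]

theorem hasInitialVelocity_of_isMIntegralCurve {S : SymmetricSpace I M} {o : M}
    {V : TangentSpace I o} {γ : ℝ → M} (h0 : γ 0 = o)
    (hγ : IsMIntegralCurve (I := I) γ (S.xi o V)) : HasInitialVelocity γ o V := by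
  have hV (y : M) (hy : y = o) : (S.xi o V y : E) = V := by
    subst hy
    exact S.xi_base y V
  refine ⟨h0, (hγ 0).congr_mfderiv ?_⟩
  rw [hV (γ 0) h0]

variable [T2Space M]

theorem sym_integralCurve_neg {S : SymmetricSpace I M} {o : M} {V : TangentSpace I o}
    {α : ℝ → M} {a t : ℝ} (h0 : α 0 = o)
    (hα : IsMIntegralCurveOn (I := I) α (S.xi o V) (Set.Ioo (-a) a)) (ht : t ∈ Set.Ioo (-a) a) :
    S.op o (α (-t)) = α t := by
  have : IsManifold I 1 M := .of_le (n := ∞) (by exact_mod_cast le_top)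
  have hset : {t : ℝ | -t ∈ Set.Ioo (-a) a} = Set.Ioo (-a) a := by
    ext u
    simp only [Set.mem_ofPred_eq, Set.mem_Ioo]
    constructor <;> rintro ⟨h₁, h₂⟩ <;> constructor <;> linarith
  have hβ := isMIntegralCurveOn_sym_neg hα
  rw [hset] at hβ
  exact isMIntegralCurveOn_Ioo_eqOn_of_contMDiff_boundaryless (t₀ := 0)
    ⟨by linarith [ht.1, ht.2], by linarith [ht.1, ht.2]⟩ (S.contMDiff_one_xi o V) hβ hα
    (by simp [h0, S.op_self]) ht

/-- An integral curve of `ξ_V` through `o` on `(-a, a)` extends to `(-3a/2, 3a/2)`. -/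
theorem exists_isMIntegralCurveOn_extend {S : SymmetricSpace I M} {o : M} {V : TangentSpace I o}
    {α : ℝ → M} {a : ℝ} (ha : 0 < a) (h0 : α 0 = o)
    (hα : IsMIntegralCurveOn (I := I) α (S.xi o V) (Set.Ioo (-a) a)) :
    ∃ β : ℝ → M, β 0 = o ∧
      IsMIntegralCurveOn (I := I) β (S.xi o V) (Set.Ioo (-(3 / 2 * a)) (3 / 2 * a)) := by
  classical
  have : IsManifold I 1 M := .of_le (n := ∞) (by exact_mod_cast le_top)
  have hv := S.contMDiff_one_xi o V
  obtain ⟨β, hβ0, hβ⟩ : ∃ β : ℝ → M, β 0 = o ∧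
      IsMIntegralCurveOn (I := I) β (S.xi o V) (Set.Ioo (-a) (3 / 2 * a)) := by
    have h₁ : IsMIntegralCurveOn (I := I) (α ∘ (· + -(a / 2))) (S.xi o V)
        (Set.Ioo 0 (3 / 2 * a)) :=
      (hα.comp_add _).mono fun u hu => ⟨by linarith [hu.1], by linarith [hu.2]⟩
    have h₂ : IsMIntegralCurveOn (I := I) (α ∘ (· + -a)) (S.xi o V)
        (Set.Ioo 0 (3 / 2 * a)) :=
      (hα.comp_add _).mono fun u hu => ⟨by linarith [hu.1], by linarith [hu.2]⟩
    have h₃ := isMIntegralCurveOn_piecewise (t₀ := a / 2) hv hα (isMIntegralCurveOn_op h₁ h₂)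
      ⟨⟨by linarith, by linarith⟩, ⟨by linarith, by linarith⟩⟩ (by
        rw [← sym_integralCurve_neg h0 hα ⟨by linarith, by linarith⟩]
        simp only [Function.comp_apply, add_neg_cancel, h0]
        congr 2
        ring)
    refine ⟨_, ?_, h₃.mono
      (Set.Ioo_subset_Ioo_union_Ioo le_rfl (by linarith) le_rfl)⟩
    rw [Set.piecewise_eq_of_mem _ _ _ (by constructor <;> linarith), h0]
  have hβ' := (isMIntegralCurveOn_sym_neg hβ).mono
    (s' := Set.Ioo (-(3 / 2 * a)) a) fun u hu => ⟨by linarith [hu.2], by linarith [hu.1]⟩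
  have h₃ := isMIntegralCurveOn_piecewise (t₀ := 0) hv hβ' hβ
    ⟨⟨by linarith, by linarith⟩, ⟨by linarith, by linarith⟩⟩ (by simp [hβ0, S.op_self])
  refine ⟨_, ?_, h₃.mono (Set.Ioo_subset_Ioo_union_Ioo le_rfl (by linarith) le_rfl)⟩
  rw [Set.piecewise_eq_of_mem _ _ _ (by constructor <;> linarith), neg_zero, hβ0, S.op_self]

theorem exists_isMIntegralCurve_xi (S : SymmetricSpace I M) (o : M) (V : TangentSpace I o) :
    ∃ γ : ℝ → M, γ 0 = o ∧ IsMIntegralCurve (I := I) γ (S.xi o V) := by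
  have : IsManifold I 1 M := .of_le (n := ∞) (by exact_mod_cast le_top)
  have hv := S.contMDiff_one_xi o V
  rw [exists_isMIntegralCurve_iff_exists_isMIntegralCurveOn_Ioo hv]
  obtain ⟨α, h0, hα⟩ := exists_isMIntegralCurveAt_of_contMDiffAt_boundaryless 0 (hv o)
  obtain ⟨ε, hε, hα⟩ := isMIntegralCurveAt_iff'.1 hα
  have hn (n : ℕ) : ∃ γ : ℝ → M, γ 0 = o ∧ IsMIntegralCurveOn (I := I) γ (S.xi o V)
      (Set.Ioo (-((3 / 2) ^ n * ε)) ((3 / 2) ^ n * ε)) := by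
    induction n with
    | zero => exact ⟨α, h0, by simpa [Real.ball_eq_Ioo] using hα⟩
    | succ n ih =>
      obtain ⟨γ, hγ0, hγ⟩ := ih
      obtain ⟨β, hβ0, hβ⟩ := exists_isMIntegralCurveOn_extend (by positivity) hγ0 hγ
      refine ⟨β, hβ0, ?_⟩
      rwa [← mul_assoc, ← pow_succ'] at hβ
  intro a
  obtain ⟨n, hn'⟩ := pow_unbounded_of_one_lt (a / ε) (by norm_num : (1 : ℝ) < 3 / 2)
  obtain ⟨γ, hγ0, hγ⟩ := hn n
  have hle : a ≤ (3 / 2) ^ n * ε := ((div_lt_iff₀ hε).1 hn').le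
  exact ⟨γ, hγ0, hγ.mono (Set.Ioo_subset_Ioo (neg_le_neg hle) hle)⟩

/-- Integral curves of `ξ_V` through `o` are homomorphisms of pointed symmetric spaces. -/
theorem isPointedHom_of_isMIntegralCurve {S : SymmetricSpace I M} {o : M}
    {V : TangentSpace I o} {γ : ℝ → M} (h0 : γ 0 = o)
    (hγ : IsMIntegralCurve (I := I) γ (S.xi o V)) : IsPointedHom realLine 0 S o γ where
  map_base := h0
  map_op s t := by
    have hneg (c : ℝ) : S.op o (γ (-c)) = γ c :=
      sym_integralCurve_neg (a := |c| + 1) h0 (hγ.isMIntegralCurveOn _)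
        (abs_lt.1 (lt_add_one |c|))
    have hprod : IsMIntegralCurve (I := I) (fun u => S.op (γ u) ((γ ∘ (· + (t - s))) u))
        (S.xi o V) :=
      isMIntegralCurve_iff_isMIntegralCurveOn.2
        (isMIntegralCurveOn_op (hγ.isMIntegralCurveOn _) ((hγ.comp_add _).isMIntegralCurveOn _))
    have h := congrFun (eq_of_isMIntegralCurve_xi hprod (hγ.comp_add (s - t)) (by
      simp only [Function.comp_apply, zero_add, h0]
      rw [← hneg (s - t), neg_sub])) s
    simp only [Function.comp_apply, add_sub_cancel] at h
    rw [h]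
    congr 1
    change 2 * s - t = _
    ring

end SymmetricSpace

theorem mainTheorem4 {E : Type*} [NormedAddCommGroup E] [NormedSpace ℝ E] [FiniteDimensional ℝ E]
    {H : Type*} [TopologicalSpace H] (I : ModelWithCorners ℝ E H) [I.Boundaryless]
    {M : Type*} [TopologicalSpace M] [T2Space M] [ChartedSpace H M] [IsManifold I ∞ M]
    (S : SymmetricSpace I M) (o : M) (V : TangentSpace I o) :
    -- `t ↦ Exp(tV)` is the unique solution of `y' = ξ_V(y)`, `y(0) = o` on all of `ℝ`
    (∀ γ : ℝ → M, (γ 0 = o ∧ IsMIntegralCurve (I := I) γ (S.xi o V)) ↔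
      γ = fun t : ℝ => S.geodesicExp o (t • V)) ∧
    -- it is a smooth homomorphism of pointed symmetric spaces with derivative `V` at `0`
    ContMDiff 𝓘(ℝ, ℝ) I ∞ (fun t : ℝ => S.geodesicExp o (t • V)) ∧
    SymmetricSpace.IsPointedHom SymmetricSpace.realLine 0 S o
      (fun t : ℝ => S.geodesicExp o (t • V)) ∧
    SymmetricSpace.HasInitialVelocity (fun t : ℝ => S.geodesicExp o (t • V)) o V ∧
    -- and the only homomorphism of pointed symmetric spaces with derivative `V` at `0`
    (∀ f : ℝ → M, SymmetricSpace.IsPointedHom SymmetricSpace.realLine 0 S o f →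
      SymmetricSpace.HasInitialVelocity f o V →
      f = fun t : ℝ => S.geodesicExp o (t • V)) ∧
    -- relation with the quadratic representation
    S.geodesicExp o V = S.quadRep o (S.geodesicExp o ((1 / 2 : ℝ) • V)) o := by 
  have : CompleteSpace E := FiniteDimensional.complete ℝ E
  obtain ⟨γ, h0, hγ⟩ := S.exists_isMIntegralCurve_xi o V
  have hExp := SymmetricSpace.eq_geodesicExp_of_isMIntegralCurve h0 hγ
  have hhom := SymmetricSpace.isPointedHom_of_isMIntegralCurve h0 hγ
  rw [← hExp]
  refine ⟨fun β => ⟨fun h => ?_, ?_⟩, hγ.contMDiff (S.contMDiff_xi o V), hhom,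
    SymmetricSpace.hasInitialVelocity_of_isMIntegralCurve h0 hγ, fun f hf hV => ?_, ?_⟩
  · exact (SymmetricSpace.eq_geodesicExp_of_isMIntegralCurve h.1 h.2).trans hExp.symm
  · rintro rfl
    exact ⟨h0, hγ⟩
  · exact SymmetricSpace.eq_of_isMIntegralCurve_xi (hf.isMIntegralCurve hV) hγ
      (hf.map_base.trans h0.symm)
  · have h₁ : S.geodesicExp o V = γ 1 := by simp only [hExp, one_smul]
    have h₂ : S.geodesicExp o ((1 / 2 : ℝ) • V) = γ (1 / 2) := by rw [hExp]
    have hop : γ (2 * (1 / 2) - 0) = S.op (γ (1 / 2)) (γ 0) := hhom.map_op _ _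
    rw [h0] at hop
    rw [h₁, h₂, S.quadRep_apply_base, ← hop]
    norm_num
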